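/- Let $\mathbb F$ be a field of characteristic different from $2$. For a strictly lower triangular $n\times n$ matrix $T=[t_{ij}]$ over $\mathbb F$ let $\mathcal A(T)$ be the commutative unital $\mathbb F$-algebra with generators $X_1,\dots,X_n$ and relations $X_i^2=\sum_{j<i}t_{ij}X_jX_i$ ($1\le i\le n$), graded by $\deg X_i=2$. Isomorphisms $\mathcal A(T)\to\mathcal A(S)$ are degree-preserving algebra isomorphisms, and $T\sim S$ means that one exists. Let $c_r$ be the column of the last nonzero entry of the row $r$ of $T$ ($c_r=0$ for a zero row), and $\Delta_{i,j,k}(T)=2t_{ki}+t_{kj}t_{ji}$. For integers $a,b$ put $[a,b[\,=\{m\in\mathbb Z:a\le m<b\}$. Call $T$ leader-reduced if its zero rows are above its nonzero rows and, for each nonzero row $r$, $c_r>1$ and $\Delta_{i,c_r,r}(T)\ne0$ for some $1\le i<c_r$. A nonzero $T$ is in first reduced echelon form if it is leader-reduced and $c_r\le c_{r+1}$ whenever the rows $r,r+1$ are nonzero; its wall is then $\mathbb W(T)=(r_1,\dots,r_h)$, where $r_1$ is the first nonzero row, $r_{j+1}=\min\{r>r_j: c_r\ge r_j\}$, and the sequence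 stops when this set is empty. The zero matrix is in first reduced echelon form, with wall $(0)$. For arbitrary strictly lower triangular $T$, $\mathbb W(T):=\mathbb W(R)$ for any strictly lower triangular $R\sim T$ in first reduced echelon form (this is well defined). With $\mathbb W(T)=(r_1,\dots,r_h)$ put $r_0=1$ and $r_{h+1}=n+1$. For $1\le q\le h$ and $r\in[r_q,r_{q+1}[$ let $J^{(q)}_r=\{j\in[r_{q-1},r_q[\,:t_{rj}\ne0\}$ and $\mu_r=|J^{(q)}_r|$. A matrix $T\not\sim0$ is in second reduced echelon form if it has exactly $r_1-1$ zero rows, is leader-reduced, and for each $1\le j\le h$ satisfies $c_r\in[r_{j-1},r_j[$ for $r\in[r_j,r_{j+1}[$ and $\mu_r\le\mu_{r+1}$ for $r\in[r_j,r_{j+1}-1[$. Its measure sequence is $\mathbb M(T)=(M_1,\dots,M_h)$, where $M_j$ has the columns $(r_{j,i},\mu_{r_{j,i}})$, $1\le i\le l(j)$, with $r_{j,1}=r_j$ and $r_{j,i+1}=\min\{r\in\,]r_{j,i},r_{j+1}[\,:\mu_r>\mu_{r_{j,i}}\}$ as long as this set is nonempty; put $r_{j,l(j)+1}=r_{j+1}$.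 **Theorem.** Let $T=[t_{ij}]$ and $S=[s_{ij}]$ be nonzero strictly lower triangular $n\times n$ matrices in second reduced echelon form with $\mathbb W(T)=\mathbb W(S)=(r_1,\dots,r_h)$ and $\mathbb M(T)=\mathbb M(S)$. Let $\gamma:\mathcal A(T)\to\mathcal A(S)$ be an isomorphism, and let $X_j$, $Y_i$ be the generators of $\mathcal A(T)$, $\mathcal A(S)$. Then there is a unique matrix $\Gamma=[\gamma_{ij}]$ with $\gamma(X_j)=\sum_i\gamma_{ij}Y_i$ for all $j$, and: 1. if $0\le j\le h$ and $r\in[r_j,r_{j+1}[$, then $\gamma_{kr}=0$ for all $k\ge r_{j+1}$; 2. there is a bijection $\rho:\{1,\dots,n\}\to\{1,\dots,n\}$ such that (a) $\rho([r_j,r_{j+1}[)=[r_j,r_{j+1}[$ for $0\le j\le h$; (b) for $0\le j\le h$ and $i,k\in[r_j,r_{j+1}[$, $\gamma_{ik}\ne0$ if and only if $k=\rho(i)$; (c) $\rho([r_{j,i},r_{j,i+1}[)=[r_{j,i},r_{j,i+1}[$ for $1\le j\le h$ and $1\le i\le l(j)$; 3. for every bijection $\rho$ satisfying (a), (b), (c),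 every $1\le q\le h$ and every $k\in[r_q,r_{q+1}[$, $\rho(I^{(q)}_k)=J^{(q)}_{\rho(k)}$, where $I^{(q)}_k=\{j\in[r_{q-1},r_q[\,:s_{kj}\ne0\}$. -/

import Mathlib

namespace NT

/-! ## The algebra `A(T)`, its grading, its isomorphisms -/

section Algebra

variable {F : Type*} [Field F] {n : ℕ}

/-- Strictly lower triangular matrices. -/
def IsSLTM (T : Matrix (Fin n) (Fin n) F) : Prop :=
  ∀ i j : Fin n, i ≤ j → T i j = 0

/-- The defining relation `X_i ^ 2 - ∑_{j < i} t_{ij} X_j X_i`; for the first generator the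
sum is empty. -/
noncomputable def rel (T : Matrix (Fin n) (Fin n) F) (i : Fin n) : MvPolynomial (Fin n) F :=
  MvPolynomial.X i ^ 2 -
    ∑ j ∈ Finset.Iio i, MvPolynomial.C (T i j) * MvPolynomial.X j * MvPolynomial.X i

/-- The ideal generated by the defining relations. -/
noncomputable abbrev nilIdeal (T : Matrix (Fin n) (Fin n) F) : Ideal (MvPolynomial (Fin n) F) :=
  Ideal.span (Set.range (rel T))

/-- The nil graded algebra `A(T)`. -/
noncomputable abbrev NilAlg (T : Matrix (Fin n) (Fin n) F) : Type _ :=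
  MvPolynomial (Fin n) F ⧸ nilIdeal T

/-- The generators of `A(T)`. -/
noncomputable def gen (T : Matrix (Fin n) (Fin n) F) (i : Fin n) : NilAlg T :=
  Ideal.Quotient.mk (nilIdeal T) (MvPolynomial.X i)

/-- The homogeneous part of degree `d` of `A(T)`, every generator having degree `2`. -/
noncomputable def degPart (T : Matrix (Fin n) (Fin n) F) (d : ℕ) : Submodule F (NilAlg T) :=
  (MvPolynomial.weightedHomogeneousSubmodule F (fun _ : Fin n => 2) d).map
    (Ideal.Quotient.mkₐ F (nilIdeal T)).toLinearMap

/-- An algebra isomorphism which, together with its inverse, preserves degrees. -/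
def IsGraded {T S : Matrix (Fin n) (Fin n) F} (γ : NilAlg T ≃ₐ[F] NilAlg S) : Prop :=
  ∀ (d : ℕ) (x : NilAlg T), x ∈ degPart T d ↔ γ x ∈ degPart S d

/-- The relation `T ∼ S`: the graded algebras `A(T)` and `A(S)` are isomorphic. -/
def Equivalent (T S : Matrix (Fin n) (Fin n) F) : Prop :=
  ∃ γ : NilAlg T ≃ₐ[F] NilAlg S, IsGraded γ

/-- `Γ` is the matrix of `γ`: `γ(X_j) = ∑_i Γ_{ij} Y_i`. -/
def IsMatrixOf {T S : Matrix (Fin n) (Fin n) F} (γ : NilAlg T ≃ₐ[F] NilAlg S)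
    (Γ : Matrix (Fin n) (Fin n) F) : Prop :=
  ∀ j : Fin n, γ (gen T j) = ∑ i : Fin n, Γ i j • gen S i

end Algebra

/-! ## Echelon forms, walls, measure sequences

Rows and columns are numbered `1, …, n`; the index `i : Fin n` has number `i + 1`. -/

section Forms

variable {F : Type*} [Field F] {n : ℕ}

/-- The entry of `T` in the row number `r` and the column number `c` (`0` off the matrix). -/
def entry (T : Matrix (Fin n) (Fin n) F) (r c : ℕ) : F :=
  if h : (1 ≤ r ∧ r ≤ n) ∧ (1 ≤ c ∧ c ≤ n) then
    T ⟨r - 1, by omega⟩ ⟨c - 1, by omega⟩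
  else 0

theorem entry_succ (T : Matrix (Fin n) (Fin n) F) (i j : Fin n) :
    entry T ((i : ℕ) + 1) ((j : ℕ) + 1) = T i j := by
  have hi := i.isLt
  have hj := j.isLt
  have h : (1 ≤ (i : ℕ) + 1 ∧ (i : ℕ) + 1 ≤ n) ∧ (1 ≤ (j : ℕ) + 1 ∧ (j : ℕ) + 1 ≤ n) := by
    omega
  simp [entry, h]

/-- The row number `r` is a zero row. -/
def ZeroRow (T : Matrix (Fin n) (Fin n) F) (r : ℕ) : Prop :=
  ∀ c ∈ Finset.Icc 1 n, entry T r c = 0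

open Classical in
/-- The column number `c_r` of the leader (last nonzero entry) of the row `r`, and `0` for a
zero row. -/
noncomputable def lead (T : Matrix (Fin n) (Fin n) F) (r : ℕ) : ℕ :=
  ((Finset.Icc 1 n).filter (fun c => entry T r c ≠ 0)).sup id

/-- `Δ^{(α)}_{i,j,k}(T) = α t_{ki} + t_{kj} t_{ji}`. -/
def Delta (α : F) (T : Matrix (Fin n) (Fin n) F) (i j k : ℕ) : F :=
  α * entry T k i + entry T k j * entry T j i

open Classical in
/-- The measure (number of nonzero entries) of the part of the row `r` that lies in the
columns `[a, b[`. -/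
noncomputable def rowMeasure (T : Matrix (Fin n) (Fin n) F) (a b r : ℕ) : ℕ :=
  ((Finset.Ico a b).filter (fun c => entry T r c ≠ 0)).card

/-- The zero rows are above the nonzero rows. -/
def ZeroRowsFirst (T : Matrix (Fin n) (Fin n) F) : Prop :=
  ∀ r ∈ Finset.Icc 1 n, ∀ s ∈ Finset.Icc 1 n, ZeroRow T r → ¬ ZeroRow T s → r < s

/-- Each leader position `(r, c)` has `c > 1` and `Δ^{(2)}_{i,c,r} ≠ 0` for some `i < c`. -/
def LeadersReduced (T : Matrix (Fin n) (Fin n) F) : Prop :=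
  ∀ r ∈ Finset.Icc 1 n, ¬ ZeroRow T r →
    1 < lead T r ∧ ∃ i ∈ Finset.Ico 1 (lead T r), Delta 2 T i (lead T r) r ≠ 0

/-- First reduced echelon form. -/
def IsOneREF (T : Matrix (Fin n) (Fin n) F) : Prop :=
  T = 0 ∨
    (ZeroRowsFirst T ∧ LeadersReduced T ∧
      ∀ r ∈ Finset.Ico 1 n, ¬ ZeroRow T r → ¬ ZeroRow T (r + 1) → lead T r ≤ lead T (r + 1))

open Classical in
/-- The set `A = {s ∈ ]r, n] : c_s ≥ r}` of candidates for the next entry of the wall. -/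
noncomputable def wallNext (T : Matrix (Fin n) (Fin n) F) (r : ℕ) : Finset ℕ :=
  (Finset.Ioc r n).filter (fun s => r ≤ lead T s)

/-- The part of the wall that begins with its entry `r`. -/
noncomputable def wallFrom (T : Matrix (Fin n) (Fin n) F) (r : ℕ) : List ℕ :=
  open Classical in
  if h : (wallNext T r).Nonempty then r :: wallFrom T ((wallNext T r).min' h) else [r]
termination_by n - r
decreasing_by
  have h1 := Finset.min'_mem _ h
  unfold wallNext at h1 ⊢
  rw [Finset.mem_filter, Finset.mem_Ioc] at h1
  omega

open Classical in
/-- The wall of a matrix in first reduced echelon form, `(0)` for the zero matrix. -/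
noncomputable def oneREFWall (T : Matrix (Fin n) (Fin n) F) : List ℕ :=
  if h : ((Finset.Icc 1 n).filter (fun r => ¬ ZeroRow T r)).Nonempty then
    wallFrom T (((Finset.Icc 1 n).filter (fun r => ¬ ZeroRow T r)).min' h)
  else [0]

open Classical in
/-- The wall of an arbitrary strictly lower triangular matrix `T`: the wall of a matrix `R` in
first reduced echelon form with `T ∼ R` (such an `R` exists and its wall does not depend on
the choice). -/
noncomputable def wall (T : Matrix (Fin n) (Fin n) F) : List ℕ :=
  if h : ∃ R : Matrix (Fin n) (Fin n) F, IsSLTM R ∧ IsOneREF R ∧ Equivalent T R then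
    oneREFWall h.choose
  else []

/-- The numbers `r_0 = 1`, `r_1, …, r_h` and `r_{h+1} = n + 1` of a wall `(r_1, …, r_h)`. -/
def cut (n : ℕ) (w : List ℕ) (j : ℕ) : ℕ :=
  if j = 0 then 1 else w.getD (j - 1) (n + 1)

open Classical in
/-- Second reduced echelon form. -/
def IsTwoREF (T : Matrix (Fin n) (Fin n) F) : Prop :=
  T = 0 ∨
    (¬ Equivalent T 0 ∧
      ((Finset.Icc 1 n).filter (fun r => ZeroRow T r)).card + 1 = cut n (wall T) 1 ∧
      ZeroRowsFirst T ∧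
      LeadersReduced T ∧
      (∀ j ∈ Finset.Icc 1 (wall T).length,
        ∀ r ∈ Finset.Ico (cut n (wall T) j) (cut n (wall T) (j + 1)),
          lead T r ∈ Finset.Ico (cut n (wall T) (j - 1)) (cut n (wall T) j)) ∧
      (∀ j ∈ Finset.Icc 1 (wall T).length,
        ∀ r ∈ Finset.Ico (cut n (wall T) j) (cut n (wall T) (j + 1) - 1),
          rowMeasure T (cut n (wall T) (j - 1)) (cut n (wall T) j) r ≤
            rowMeasure T (cut n (wall T) (j - 1)) (cut n (wall T) j) (r + 1)))

/-- The rows of `]r, e[` whose measure in the columns `[a, b[` exceeds that of the row `r`. -/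
noncomputable def measureNext (T : Matrix (Fin n) (Fin n) F) (a b e r : ℕ) : Finset ℕ :=
  (Finset.Ioo r e).filter (fun s => rowMeasure T a b r < rowMeasure T a b s)

/-- The columns `(r_{jk}, μ_{jk})` of a measure matrix, from the one with `r_{jk} = r` on. -/
noncomputable def measureFrom (T : Matrix (Fin n) (Fin n) F) (a b e r : ℕ) : List (ℕ × ℕ) :=
  if h : (measureNext T a b e r).Nonempty then
    (r, rowMeasure T a b r) :: measureFrom T a b e ((measureNext T a b e r).min' h)
  else [(r, rowMeasure T a b r)]
termination_by e - r
decreasing_by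
  have h1 := Finset.min'_mem _ h
  unfold measureNext at h1 ⊢
  rw [Finset.mem_filter, Finset.mem_Ioo] at h1
  omega

/-- The matrix `M_j(T)` as the list of its columns `(r_{jk}, μ_{jk})`. -/
noncomputable def measureMatrix (T : Matrix (Fin n) (Fin n) F) (j : ℕ) : List (ℕ × ℕ) :=
  measureFrom T (cut n (wall T) (j - 1)) (cut n (wall T) j) (cut n (wall T) (j + 1))
    (cut n (wall T) j)

/-- The measure sequence `(M_1(T), …, M_h(T))`. -/
noncomputable def measureSequence (T : Matrix (Fin n) (Fin n) F) : List (List (ℕ × ℕ)) :=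
  (List.range (wall T).length).map (fun k => measureMatrix T (k + 1))

/-- The indices with number in `[a, b[`. -/
def seg (n a b : ℕ) : Set (Fin n) := {i | a ≤ (i : ℕ) + 1 ∧ (i : ℕ) + 1 < b}

/-- The interval `[r_j, r_{j+1}[` of a wall `w`. -/
def wallSeg (n : ℕ) (w : List ℕ) (j : ℕ) : Set (Fin n) := seg n (cut n w j) (cut n w (j + 1))

/-- The number `r_{j,i}`, `1 ≤ i ≤ l(j)`, of the measure matrix `M_j(T)`; `r_{j,l(j)+1}` is
`r_{j+1}`. -/
noncomputable def subCut (T : Matrix (Fin n) (Fin n) F) (j i : ℕ) : ℕ :=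
  ((measureMatrix T j).map Prod.fst).getD (i - 1) (cut n (wall T) (j + 1))

/-- The support `{j ∈ [r_{q-1}, r_q[ : t_{rj} ≠ 0}` of the row `r` of `T` in the `q`-th
brick. -/
def brickSupport (T : Matrix (Fin n) (Fin n) F) (q : ℕ) (r : Fin n) : Set (Fin n) :=
  {j | j ∈ wallSeg n (wall T) (q - 1) ∧ T r j ≠ 0}

/-- The bijection `ρ` preserves the wall intervals and the measure subintervals of `T`, and the
nonzero entries of the diagonal blocks of `Γ` are those in the positions `(i, ρ(i))`. -/
structure IsAdapted (T Γ : Matrix (Fin n) (Fin n) F) (ρ : Equiv.Perm (Fin n)) : Prop where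
  image_wallSeg : ∀ j ∈ Finset.Icc 0 (wall T).length,
    ρ '' wallSeg n (wall T) j = wallSeg n (wall T) j
  ne_zero_iff : ∀ j ∈ Finset.Icc 0 (wall T).length,
    ∀ i ∈ wallSeg n (wall T) j, ∀ k ∈ wallSeg n (wall T) j, Γ i k ≠ 0 ↔ k = ρ i
  image_subSeg : ∀ j ∈ Finset.Icc 1 (wall T).length,
    ∀ i ∈ Finset.Icc 1 (measureMatrix T j).length,
      ρ '' seg n (subCut T j i) (subCut T j (i + 1)) =
        seg n (subCut T j i) (subCut T j (i + 1))

end Forms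

end NT

/-! In degree 2 the algebra `A(T)` is `F^n`, so `γ` is an invertible matrix `Γ`, with inverse `Θ`.
In degree 4 only squares of linear forms are compared, through the coordinates `sqCoeff`. The
relation for `X_r` says that the axis `2 X_r - ∑ t_{rj} X_j` has the same square as `∑ t_{rj} X_j`,
a form in lower blocks of the wall.

Suppose that `Γ` and `Θ` preserve the span of the blocks below `j`. For `r` in the block `j`, the
image of the axis of `r` then has a square with no component outside the lower blocks, while the
image itself does not lie there. By `IsBlocked.exists_smul_axis` it is a multiple of an axis of the
block `j`: its last nonzero coordinate forces an axis, and reducedness of leaders excludes higher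
blocks. Induction on `j` makes `Γ` block triangular with monomial diagonal blocks, which gives `ρ`
(`blockTriangular`, `exists_perm_axis`).

The squares of `Γ T_{ρ(k)}` and of row `k` of `S` now agree up to a nonzero factor. In the block
just below that of `k`, they determine the products of distinct coordinates, and a reduced leader
cannot vanish; hence the supports agree (`row_ne_zero_iff`). So `ρ` carries the brick support of row
`k` of `S` to that of row `ρ(k)` of `T`. In particular `ρ` respects measures, and the measure
subintervals, being level sets of the measure, are preserved. -/

namespace NT

/-! ### Linear forms and their squares -/

section Quadratic

variable {F : Type*} [Field F] {n : ℕ}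

/-- The element `∑ a_i X_i` of `A(T)`. -/
noncomputable def linearForm (T : Matrix (Fin n) (Fin n) F) (a : Fin n → F) : NilAlg T :=
  ∑ i, a i • gen T i

/-- The polynomial `∑ a_i X_i`. -/
noncomputable def linearPoly (a : Fin n → F) : MvPolynomial (Fin n) F :=
  ∑ i, MvPolynomial.C (a i) * MvPolynomial.X i

theorem mk_linearPoly (T : Matrix (Fin n) (Fin n) F) (a : Fin n → F) :
    Ideal.Quotient.mk (nilIdeal T) (linearPoly a) = linearForm T a := by
  simp only [linearPoly, linearForm, gen, map_sum, map_mul]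
  refine Finset.sum_congr rfl fun i _ => ?_
  rw [← map_mul, ← MvPolynomial.smul_eq_C_mul]
  rfl

theorem pderiv_linearPoly (a : Fin n → F) (k : Fin n) :
    MvPolynomial.pderiv k (linearPoly a) = MvPolynomial.C (a k) := by
  simp only [linearPoly, map_sum, Derivation.leibniz, MvPolynomial.pderiv_C,
    smul_eq_mul, MvPolynomial.pderiv_X]
  rw [Finset.sum_eq_single k]
  · simp
  · intro i _ hi
    simp [hi.symm]
  · simp

theorem constantCoeff_linearPoly (a : Fin n → F) :
    MvPolynomial.constantCoeff (linearPoly a) = 0 := by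
  simp [linearPoly]

/-- The second partial derivative of a polynomial at the origin. -/
noncomputable def hessian (i k : Fin n) (p : MvPolynomial (Fin n) F) : F :=
  MvPolynomial.constantCoeff
    (MvPolynomial.pderiv i (MvPolynomial.pderiv k p))

theorem hessian_add (i k : Fin n) (p q : MvPolynomial (Fin n) F) :
    hessian i k (p + q) = hessian i k p + hessian i k q := by
  simp [hessian]

theorem hessian_linearPoly_mul (a b : Fin n → F) (i k : Fin n) :
    hessian i k (linearPoly a * linearPoly b) = a i * b k + a k * b i := by
  simp only [hessian, Derivation.leibniz, pderiv_linearPoly, smul_eq_mul, map_add, map_mul,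
    MvPolynomial.pderiv_C, MvPolynomial.constantCoeff_C, map_zero, mul_zero]
  ring

theorem rel_eq (T : Matrix (Fin n) (Fin n) F) (hT : IsSLTM T) (m : Fin n) :
    rel T m = linearPoly (Pi.single m 1) * linearPoly (Pi.single m 1 - T m) := by
  have h1 : linearPoly (Pi.single m (1 : F)) = MvPolynomial.X m := by
    unfold linearPoly
    rw [Finset.sum_eq_single m]
    · simp
    · intro i _ hi
      simp [hi]
    · simp
  have h2 : linearPoly (Pi.single m 1 - T m) = MvPolynomial.X m - linearPoly (T m) := by
    rw [← h1]
    simp [linearPoly, sub_mul, Finset.sum_sub_distrib]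
  rw [h1, h2, rel, mul_sub, sq]
  congr 1
  rw [linearPoly, Finset.mul_sum]
  rw [← Finset.sum_subset (Finset.subset_univ (Finset.Iio m))]
  · exact Finset.sum_congr rfl fun j _ => by ring
  · intro j _ hj
    rw [hT m j (by simpa using hj)]
    simp

/-- The elements of the ideal of relations vanish to the second order at the origin, and the
functionals dual to the monomials `X_i X_k`, `i < k`, vanish on them. -/
theorem vanish_of_mem_nilIdeal (T : Matrix (Fin n) (Fin n) F) (hT : IsSLTM T)
    {p : MvPolynomial (Fin n) F} (hp : p ∈ nilIdeal T) :
    MvPolynomial.constantCoeff p = 0 ∧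
    (∀ k, MvPolynomial.constantCoeff (MvPolynomial.pderiv k p) = 0) ∧
    ∀ i k, i < k → 2 * hessian i k p + T k i * hessian k k p = 0 := by
  induction hp using Submodule.span_induction with
  | mem x hx =>
    obtain ⟨m, rfl⟩ := hx
    rw [rel_eq T hT]
    refine ⟨by simp [constantCoeff_linearPoly], fun k => ?_, fun i k hik => ?_⟩
    · simp [Derivation.leibniz, constantCoeff_linearPoly]
    · rw [hessian_linearPoly_mul, hessian_linearPoly_mul]
      have hki := hik.ne'
      have e1 : T i k = 0 := hT i k hik.le
      have e2 : T k k = 0 := hT k k le_rfl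
      by_cases hmi : m = i
      · subst hmi
        simp [hki, e1]
      · by_cases hmk : m = k
        · subst hmk
          simp [hik.ne, e2]
          ring
        · simp [Ne.symm hmi, Ne.symm hmk]
  | zero => simp [hessian]
  | add x y _ _ hx hy =>
    refine ⟨by simp [hx.1, hy.1], fun k => by simp [hx.2.1, hy.2.1], fun i k hik => ?_⟩
    rw [hessian_add, hessian_add]
    linear_combination hx.2.2 i k hik + hy.2.2 i k hik
  | smul a x _ hx =>
    -- Since `x` and its gradient vanish at the origin, only the constant term of `a` contributes;
    -- this is why the first-order conditions are carried through the induction.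
    have key : ∀ i k, hessian i k (a * x) =
        MvPolynomial.constantCoeff a * hessian i k x := by
      intro i k
      simp [hessian, Derivation.leibniz, hx.1, hx.2.1]
    refine ⟨by simp [hx.1], fun k => by simp [Derivation.leibniz, hx.1, hx.2.1],
      fun i k hik => ?_⟩
    rw [smul_eq_mul, key, key]
    linear_combination
      (MvPolynomial.constantCoeff a) * hx.2.2 i k hik

theorem linearForm_injective (T : Matrix (Fin n) (Fin n) F) (hT : IsSLTM T) :
    Function.Injective (linearForm T) := by
  intro a b hab
  rw [← mk_linearPoly, ← mk_linearPoly, Ideal.Quotient.eq] at hab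
  funext k
  have := (vanish_of_mem_nilIdeal T hT hab).2.1 k
  rw [map_sub, map_sub, pderiv_linearPoly, pderiv_linearPoly, MvPolynomial.constantCoeff_C,
    MvPolynomial.constantCoeff_C] at this
  exact sub_eq_zero.mp this

/-- The coefficient of `X_i X_k`, `i < k`, in the square of `∑ a_i X_i` in `A(T)`. -/
def sqCoeff (T : Matrix (Fin n) (Fin n) F) (i k : Fin n) (a : Fin n → F) : F :=
  a k * (a k * T k i + 2 * a i)

theorem sqCoeff_eq_of_sq_eq (h2 : (2 : F) ≠ 0) (T : Matrix (Fin n) (Fin n) F) (hT : IsSLTM T)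
    {a b : Fin n → F} (hab : linearForm T a ^ 2 = linearForm T b ^ 2) {i k : Fin n}
    (hik : i < k) : sqCoeff T i k a = sqCoeff T i k b := by
  rw [← mk_linearPoly, ← mk_linearPoly, ← map_pow, ← map_pow, Ideal.Quotient.eq] at hab
  have h := (vanish_of_mem_nilIdeal T hT hab).2.2 i k hik
  have e : ∀ i k (p q : MvPolynomial (Fin n) F),
      hessian i k (p - q) = hessian i k p - hessian i k q := by
    intro i k p q
    simp [hessian]
  rw [e, e, sq, sq, hessian_linearPoly_mul, hessian_linearPoly_mul, hessian_linearPoly_mul,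
    hessian_linearPoly_mul] at h
  apply mul_left_cancel₀ h2
  unfold sqCoeff
  linear_combination h

theorem linearForm_add (T : Matrix (Fin n) (Fin n) F) (a b : Fin n → F) :
    linearForm T (a + b) = linearForm T a + linearForm T b := by
  simp [linearForm, add_smul, Finset.sum_add_distrib]

theorem linearForm_smul (T : Matrix (Fin n) (Fin n) F) (c : F) (a : Fin n → F) :
    linearForm T (c • a) = c • linearForm T a := by
  simp [linearForm, mul_smul, Finset.smul_sum]

/-- The vector of coefficients of `2 X_r - ∑ t_{rj} X_j`. -/
def axis (T : Matrix (Fin n) (Fin n) F) (r : Fin n) : Fin n → F :=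
  (2 : F) • Pi.single r 1 - T r

/-- Completing the square in the relation: with `t = ∑ t_{rj} X_j`, one has `(2 X_r - t)^2 - t^2 = 4
X_r (X_r - t)`, which is zero. -/
theorem linearForm_axis_sq (T : Matrix (Fin n) (Fin n) F) (hT : IsSLTM T) (r : Fin n) :
    linearForm T (axis T r) ^ 2 = linearForm T (T r) ^ 2 := by
  have h1 : linearForm T (Pi.single r 1) *
      linearForm T (Pi.single r 1 - T r) = 0 := by
    rw [← mk_linearPoly, ← mk_linearPoly, ← map_mul, ← rel_eq T hT]
    exact Ideal.Quotient.eq_zero_iff_mem.mpr (Ideal.subset_span ⟨r, rfl⟩)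
  have h2 : ∀ c : F, Pi.single r c - T r = Pi.single r c + (-1 : F) • T r := by
    intro c
    rw [neg_one_smul, sub_eq_add_neg]
  have h3 : axis T r = (2 : F) • Pi.single r 1 + (-1 : F) • T r := by
    rw [axis, neg_one_smul, sub_eq_add_neg]
  rw [h2, linearForm_add, linearForm_smul] at h1
  rw [h3, linearForm_add, linearForm_smul, linearForm_smul]
  simp only [neg_smul, one_smul, two_smul] at h1 ⊢
  linear_combination 4 * h1

theorem gen_mem_degPart (T : Matrix (Fin n) (Fin n) F) (r : Fin n) : gen T r ∈ degPart T 2 :=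
  ⟨MvPolynomial.X r, MvPolynomial.isWeightedHomogeneous_X F _ r, rfl⟩

theorem exists_linearForm_of_mem_degPart (T : Matrix (Fin n) (Fin n) F) {x : NilAlg T}
    (hx : x ∈ degPart T 2) : ∃ a, linearForm T a = x := by
  obtain ⟨p, hp, rfl⟩ := hx
  suffices h : ∃ a, linearPoly a = p by
    obtain ⟨a, rfl⟩ := h
    exact ⟨a, (mk_linearPoly T a).symm⟩
  refine ⟨fun i => p.coeff (Finsupp.single i 1), ?_⟩
  -- Every variable has weight 2, so weight 2 means total degree 1.
  have hs : ∀ d, p.coeff d ≠ 0 → ∃ i, d = Finsupp.single i 1 := by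
    intro d hd
    have h := hp hd
    rw [Finsupp.weight_apply, Finsupp.sum] at h
    simp only [smul_eq_mul] at h
    rw [← Finset.sum_mul] at h
    have hdeg : d.sum (fun _ m => m) = 1 := by
      rw [Finsupp.sum]
      omega
    exact (Finsupp.sum_eq_one_iff d).mp hdeg
  ext d
  simp only [linearPoly, MvPolynomial.coeff_sum, MvPolynomial.coeff_C_mul]
  by_cases hd : ∃ i, d = Finsupp.single i 1
  · obtain ⟨i, rfl⟩ := hd
    rw [Finset.sum_eq_single i]
    · simp
    · intro k _ hk
      rw [MvPolynomial.coeff_X, if_neg, mul_zero]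
      intro h
      exact hk (Finsupp.single_left_injective one_ne_zero h)
    · simp
  · have h0 : p.coeff d = 0 := by
      by_contra h
      exact hd (hs d h)
    rw [h0]
    refine Finset.sum_eq_zero fun k _ => ?_
    rw [MvPolynomial.coeff_X, if_neg, mul_zero]
    intro h
    exact hd ⟨k, h.symm⟩

theorem IsGraded.symm {T S : Matrix (Fin n) (Fin n) F} {γ : NilAlg T ≃ₐ[F] NilAlg S}
    (hγ : IsGraded γ) : IsGraded γ.symm := by
  intro d x
  rw [hγ d (γ.symm x), AlgEquiv.apply_symm_apply]

/-- A graded isomorphism has a matrix. -/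
theorem IsGraded.exists_isMatrixOf {T S : Matrix (Fin n) (Fin n) F}
    {γ : NilAlg T ≃ₐ[F] NilAlg S} (hγ : IsGraded γ) :
    ∃ Γ : Matrix (Fin n) (Fin n) F, IsMatrixOf γ Γ := by
  have h : ∀ j, ∃ a, linearForm S a = γ (gen T j) := fun j =>
    exists_linearForm_of_mem_degPart S ((hγ 2 _).mp (gen_mem_degPart T j))
  choose a ha using h
  exact ⟨Matrix.of fun i j => a j i, fun j => (ha j).symm⟩

theorem IsMatrixOf.unique {T S : Matrix (Fin n) (Fin n) F} (hS : IsSLTM S)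
    {γ : NilAlg T ≃ₐ[F] NilAlg S} {Γ Γ' : Matrix (Fin n) (Fin n) F} (h : IsMatrixOf γ Γ)
    (h' : IsMatrixOf γ Γ') : Γ' = Γ := by
  ext i j
  have := linearForm_injective S hS (a₁ := fun i => Γ' i j) (a₂ := fun i => Γ i j)
    ((h' j).symm.trans (h j))
  exact congrFun this i

theorem IsMatrixOf.apply_linearForm {T S : Matrix (Fin n) (Fin n) F}
    {γ : NilAlg T ≃ₐ[F] NilAlg S} {Γ : Matrix (Fin n) (Fin n) F} (h : IsMatrixOf γ Γ)
    (a : Fin n → F) : γ (linearForm T a) = linearForm S (Γ.mulVec a) := by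
  simp only [linearForm, map_sum, map_smul, h _, Matrix.mulVec, dotProduct, Finset.smul_sum,
    Finset.sum_smul, smul_smul]
  rw [Finset.sum_comm]
  exact Finset.sum_congr rfl fun i _ => Finset.sum_congr rfl fun j _ => by rw [mul_comm]

theorem IsMatrixOf.mulVec_mulVec {T S : Matrix (Fin n) (Fin n) F} (hT : IsSLTM T)
    {γ : NilAlg T ≃ₐ[F] NilAlg S} {Γ Θ : Matrix (Fin n) (Fin n) F} (h : IsMatrixOf γ Γ)
    (h' : IsMatrixOf γ.symm Θ) (a : Fin n → F) : Θ.mulVec (Γ.mulVec a) = a := by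
  apply linearForm_injective T hT
  rw [← h'.apply_linearForm, ← h.apply_linearForm, AlgEquiv.symm_apply_apply]

theorem IsMatrixOf.mulVec_mulVec_symm {T S : Matrix (Fin n) (Fin n) F} (hS : IsSLTM S)
    {γ : NilAlg T ≃ₐ[F] NilAlg S} {Γ Θ : Matrix (Fin n) (Fin n) F} (h : IsMatrixOf γ Γ)
    (h' : IsMatrixOf γ.symm Θ) (a : Fin n → F) : Γ.mulVec (Θ.mulVec a) = a := by
  apply linearForm_injective S hS
  rw [← h.apply_linearForm, ← h'.apply_linearForm, AlgEquiv.apply_symm_apply]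

theorem IsMatrixOf.sqCoeff_eq (h2 : (2 : F) ≠ 0) {T S : Matrix (Fin n) (Fin n) F}
    (hT : IsSLTM T) (hS : IsSLTM S) {γ : NilAlg T ≃ₐ[F] NilAlg S}
    {Γ : Matrix (Fin n) (Fin n) F} (h : IsMatrixOf γ Γ) (r : Fin n) {i k : Fin n}
    (hik : i < k) :
    sqCoeff S i k (Γ.mulVec (axis T r)) = sqCoeff S i k (Γ.mulVec (T r)) := by
  apply sqCoeff_eq_of_sq_eq h2 S hS _ hik
  rw [← h.apply_linearForm, ← h.apply_linearForm, ← map_pow, ← map_pow,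
    linearForm_axis_sq T hT]

end Quadratic

/-! ### Block triangularity and the permutation of axes -/

section Blocks

variable {F : Type*} [Field F] {n : ℕ}

/-- The nonzero rows of `T` in the block number `j` of the monotone sequence `b` of block numbers
have their leaders in the block number `j - 1`, and the leaders are reduced. -/
structure IsBlocked (T : Matrix (Fin n) (Fin n) F) (b : Fin n → ℕ) : Prop where
  mono : Monotone b
  lt_of_ne_zero : ∀ r m, T r m ≠ 0 → b m < b r
  exists_lead : ∀ r, 0 < b r → ∃ c, b c + 1 = b r ∧ T r c ≠ 0 ∧
    ∃ i < c, 2 * T r i + T r c * T c i ≠ 0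

/-- The vectors supported in the blocks with number less than `j`. -/
def SupportedBelow (b : Fin n → ℕ) (j : ℕ) (a : Fin n → F) : Prop :=
  ∀ k, j ≤ b k → a k = 0

theorem supportedBelow_mulVec {b : Fin n → ℕ} {j : ℕ} {Γ : Matrix (Fin n) (Fin n) F}
    (h : ∀ m k, b m < j → j ≤ b k → Γ k m = 0) {a : Fin n → F} (ha : SupportedBelow b j a) :
    SupportedBelow b j (Γ.mulVec a) := by
  intro k hk
  rw [Matrix.mulVec, dotProduct]
  refine Finset.sum_eq_zero fun m _ => ?_
  by_cases hm : b m < j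
  · rw [h m k hm hk, zero_mul]
  · rw [ha m (not_lt.mp hm), mul_zero]

theorem IsBlocked.axis_apply_of_le {T : Matrix (Fin n) (Fin n) F} {b : Fin n → ℕ}
    (hT : IsBlocked T b) {r i : Fin n} (h : b r ≤ b i) :
    axis T r i = if i = r then 2 else 0 := by
  have h0 : T r i = 0 := by
    by_contra h1
    exact absurd (hT.lt_of_ne_zero r i h1) (not_lt.mpr h)
  by_cases hi : i = r
  · subst hi
    simp [axis, h0]
  · simp [axis, h0, hi]

variable {T S Γ Θ : Matrix (Fin n) (Fin n) F} {b : Fin n → ℕ}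

/-- A vector whose square has no component outside the blocks below `j`, and which is not
supported there itself, is a multiple of an axis of the block `j`. -/
theorem IsBlocked.exists_smul_axis (h2 : (2 : F) ≠ 0) (hS : IsBlocked S b) {j : ℕ}
    {y : Fin n → F} (hy : ¬ SupportedBelow b j y)
    (hsq : ∀ i k, i < k → j ≤ b k → sqCoeff S i k y = 0) :
    ∃ m, b m = j ∧ ∃ c : F, c ≠ 0 ∧ y = c • axis S m := by
  classical
  unfold SupportedBelow at hy
  push Not at hy
  obtain ⟨k, hk, hyk⟩ := hy
  obtain ⟨m, hm, hmax⟩ := (Finset.univ.filter fun i => y i ≠ 0).exists_max_image id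
    ⟨k, by simpa using hyk⟩
  simp only [Finset.mem_filter, Finset.mem_univ, true_and, id] at hm hmax
  have hjm : j ≤ b m := hk.trans (hS.mono (hmax k hyk))
  -- With `m` the last index in the support of `y`, these equations determine all earlier
  -- coordinates from `y m`.
  have hlow : ∀ i < m, y m * S m i + 2 * y i = 0 := fun i hi =>
    (mul_eq_zero.mp (hsq i m hi hjm)).resolve_left hm
  have hSge : ∀ i, m ≤ i → S m i = 0 := by
    intro i hi
    by_contra h1
    exact absurd (hS.lt_of_ne_zero m i h1) (not_lt.mpr (hS.mono hi))
  -- The factor is `y m / 2` because the axis of `m` has coordinate 2 at `m`.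
  refine ⟨m, ?_, y m / 2, div_ne_zero hm h2, ?_⟩
  · by_contra hne
    -- If `m` were above the block `j`, the column `c` would lie in a block numbered at least `j`,
    -- so the vanishing also applies at `c`. Both descriptions of `y i` together make the
    -- reducedness expression at `c` vanish.
    obtain ⟨c, hc, hSc, i, hi, hD⟩ := hS.exists_lead m (by omega)
    have hcm : c < m := by
      by_contra h
      exact hSc (hSge c (not_lt.mp h))
    have hyc : y c ≠ 0 := by
      intro h0
      have := hlow c hcm
      rw [h0, mul_zero, add_zero] at this
      exact (mul_ne_zero hm hSc) this
    have h3 := (mul_eq_zero.mp (hsq i c hi (by omega))).resolve_left hyc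
    have h4 := hlow c hcm
    have h5 := hlow i (hi.trans hcm)
    apply mul_ne_zero hm hD
    linear_combination S c i * h4 + 2 * h5 - 2 * h3
  · funext i
    rcases lt_trichotomy i m with hi | hi | hi
    · have := hlow i hi
      simp only [axis, Pi.smul_apply, Pi.sub_apply, smul_eq_mul, Pi.single_eq_of_ne hi.ne]
      field_simp
      linear_combination this
    · subst hi
      simp [axis, hSge i le_rfl, h2]
    · have h0 : y i = 0 := by
        by_contra h
        exact absurd (hmax i h) (not_le.mpr hi)
      simp [axis, hSge i hi.le, hi.ne', h0]

/-- Triangularity of `Γ` kills the square outside the lower blocks; triangularity of `Θ` keeps the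
image from falling into them, since `Θ` would bring it back to an axis whose coordinate at `r` is 2.
-/
theorem exists_smul_axis_of_supportedBelow (h2 : (2 : F) ≠ 0) (hT : IsBlocked T b)
    (hS : IsBlocked S b) (hΘ : ∀ a, Θ.mulVec (Γ.mulVec a) = a)
    (hsq : ∀ r i k, i < k →
      sqCoeff S i k (Γ.mulVec (axis T r)) = sqCoeff S i k (Γ.mulVec (T r)))
    {j : ℕ} (hΓj : ∀ m k, b m < j → j ≤ b k → Γ k m = 0)
    (hΘj : ∀ m k, b m < j → j ≤ b k → Θ k m = 0) {r : Fin n} (hr : b r = j) :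
    ∃ m, b m = j ∧ ∃ c : F, c ≠ 0 ∧ Γ.mulVec (axis T r) = c • axis S m := by
  have hTr : SupportedBelow b j (T r) := by
    intro k hk
    by_contra h
    have := hT.lt_of_ne_zero r k h
    omega
  refine hS.exists_smul_axis h2 (fun h => ?_) fun i k hik hk => ?_
  · have h1 := supportedBelow_mulVec hΘj h
    rw [hΘ] at h1
    have h3 := h1 r hr.ge
    rw [hT.axis_apply_of_le le_rfl, if_pos rfl] at h3
    exact h2 h3
  · rw [hsq r i k hik, sqCoeff, supportedBelow_mulVec hΓj hTr k hk, zero_mul]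

/-- The matrix is block triangular up to the block `j`. -/
theorem apply_eq_zero_of_smul_axis (h2 : (2 : F) ≠ 0) (hT : IsBlocked T b)
    (hS : IsBlocked S b) {j : ℕ} (hΓj : ∀ m k, b m < j → j ≤ b k → Γ k m = 0)
    {r m : Fin n} (hr : b r = j) (hm : b m = j) {c : F}
    (h : Γ.mulVec (axis T r) = c • axis S m) {k : Fin n} (hk : j ≤ b k) :
    Γ k r = if k = m then c else 0 := by
  have hTr : SupportedBelow b j (T r) := by
    intro k hk
    by_contra h
    have := hT.lt_of_ne_zero r k h
    omega
  have h1 := congrFun h k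
  rw [axis, Matrix.mulVec_sub, Matrix.mulVec_smul, Matrix.mulVec_single_one, Pi.sub_apply,
    supportedBelow_mulVec hΓj hTr k hk, Pi.smul_apply, Pi.smul_apply,
    hS.axis_apply_of_le (by omega)] at h1
  simp only [Matrix.col_apply, smul_eq_mul, sub_zero] at h1
  apply mul_left_cancel₀ h2
  rw [h1]
  split_ifs <;> ring

/-- The induction treats `Γ` and `Θ` together, because each step for one of them uses the previous
blocks of both. -/
theorem blockTriangular (h2 : (2 : F) ≠ 0) (hT : IsBlocked T b)
    (hS : IsBlocked S b) (hΘ : ∀ a, Θ.mulVec (Γ.mulVec a) = a)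
    (hΓ : ∀ a, Γ.mulVec (Θ.mulVec a) = a)
    (hsq : ∀ r i k, i < k →
      sqCoeff S i k (Γ.mulVec (axis T r)) = sqCoeff S i k (Γ.mulVec (T r)))
    (hsq' : ∀ r i k, i < k →
      sqCoeff T i k (Θ.mulVec (axis S r)) = sqCoeff T i k (Θ.mulVec (S r))) (j : ℕ) :
    (∀ m k, b m < j → j ≤ b k → Γ k m = 0) ∧ ∀ m k, b m < j → j ≤ b k → Θ k m = 0 := by
  induction j with
  | zero => exact ⟨fun m k h => absurd h (by omega), fun m k h => absurd h (by omega)⟩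
  | succ j ih =>
    obtain ⟨ih1, ih2⟩ := ih
    constructor <;> intro m k hm hk
    · rcases Nat.lt_succ_iff_lt_or_eq.mp hm with h | h
      · exact ih1 m k h (by omega)
      · obtain ⟨l, hl, c, -, e⟩ := exists_smul_axis_of_supportedBelow h2 hT hS hΘ hsq ih1 ih2 h
        rw [apply_eq_zero_of_smul_axis h2 hT hS ih1 h hl e (by omega), if_neg]
        rintro rfl
        omega
    · rcases Nat.lt_succ_iff_lt_or_eq.mp hm with h | h
      · exact ih2 m k h (by omega)
      · obtain ⟨l, hl, c, -, e⟩ :=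
          exists_smul_axis_of_supportedBelow h2 hS hT hΓ hsq' ih2 ih1 h
        rw [apply_eq_zero_of_smul_axis h2 hS hT ih2 h hl e (by omega), if_neg]
        rintro rfl
        omega

/-- Axes sent to multiples of the same axis would be proportional, by invertibility of `Γ`. Within
its own block an axis is twice a unit vector, so distinct axes of one block are not proportional.
The permutation is the inverse of the map on axes induced by `Γ`. -/
theorem exists_perm_axis (h2 : (2 : F) ≠ 0) (hT : IsBlocked T b)
    (hS : IsBlocked S b) (hΘ : ∀ a, Θ.mulVec (Γ.mulVec a) = a)
    (hΓ : ∀ a, Γ.mulVec (Θ.mulVec a) = a)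
    (hsq : ∀ r i k, i < k →
      sqCoeff S i k (Γ.mulVec (axis T r)) = sqCoeff S i k (Γ.mulVec (T r)))
    (hsq' : ∀ r i k, i < k →
      sqCoeff T i k (Θ.mulVec (axis S r)) = sqCoeff T i k (Θ.mulVec (S r))) :
    ∃ (ρ : Equiv.Perm (Fin n)) (c : Fin n → F), ∀ k, b (ρ k) = b k ∧ c k ≠ 0 ∧
      Γ.mulVec (axis T (ρ k)) = c k • axis S k := by
  have tri := blockTriangular h2 hT hS hΘ hΓ hsq hsq'
  have h : ∀ r, ∃ m, b m = b r ∧ ∃ c : F, c ≠ 0 ∧ Γ.mulVec (axis T r) = c • axis S m :=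
    fun r => exists_smul_axis_of_supportedBelow h2 hT hS hΘ hsq (tri (b r)).1 (tri (b r)).2 rfl
  choose σ hσ c hc he using h
  have inj : Function.Injective σ := by
    intro r r' hrr
    have h1 : Γ.mulVec (c r' • axis T r) = Γ.mulVec (c r • axis T r') := by
      rw [Matrix.mulVec_smul, Matrix.mulVec_smul, he, he, hrr, smul_comm]
    have h3 : c r' • axis T r = c r • axis T r' := by
      rw [← hΘ (c r' • axis T r), h1, hΘ]
    have hb : b r = b r' := by rw [← hσ r, ← hσ r', hrr]
    have h4 := congrFun h3 r
    rw [Pi.smul_apply, Pi.smul_apply, hT.axis_apply_of_le le_rfl,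
      hT.axis_apply_of_le hb.ge, if_pos rfl] at h4
    by_contra hne
    rw [if_neg hne, smul_zero] at h4
    exact mul_ne_zero (hc r') h2 h4
  let ρ := (Equiv.ofBijective σ (Finite.injective_iff_bijective.mp inj)).symm
  have hρ : ∀ k, σ (ρ k) = k := fun k => Equiv.ofBijective_apply_symm_apply σ _ k
  refine ⟨ρ, fun k => c (ρ k), fun k => ⟨?_, hc _, ?_⟩⟩
  · rw [← hσ (ρ k), hρ]
  · rw [he, hρ]

theorem sqCoeff_smul (S : Matrix (Fin n) (Fin n) F) (i k : Fin n) (c : F) (a : Fin n → F) :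
    sqCoeff S i k (c • a) = c ^ 2 * sqCoeff S i k a := by
  simp only [sqCoeff, Pi.smul_apply, smul_eq_mul]
  ring

theorem IsBlocked.sqCoeff_row_of_eq (hS : IsBlocked S b) {i l k : Fin n} (h : b i = b l) :
    sqCoeff S i l (S k) = 2 * (S k i * S k l) := by
  have h0 : S l i = 0 := by
    by_contra h1
    exact absurd (hS.lt_of_ne_zero l i h1) (by omega)
  rw [sqCoeff, h0]
  ring

/-- In the block below the one of `k`, the vector `Γ T_{ρ(k)}` and the row `k` of `S` have the
same support. -/
theorem row_ne_zero_iff (h2 : (2 : F) ≠ 0) (hS : IsBlocked S b) {k : Fin n} {c : F}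
    (hc : c ≠ 0) {a : Fin n → F}
    (h : ∀ i l, i < l → sqCoeff S i l a = c ^ 2 * sqCoeff S i l (S k)) {i : Fin n}
    (hi : b i + 1 = b k) : a i ≠ 0 ↔ S k i ≠ 0 := by
  obtain ⟨l, hl, hSl, m, hm, hD⟩ := hS.exists_lead k (by omega)
  -- The coordinate of the square at `(m, l)` has the factor `a l`, and for the row of `S` it is
  -- nonzero by reducedness.
  have hal : a l ≠ 0 := by
    intro h0
    have h1 := h m l hm
    rw [sqCoeff, h0, zero_mul, sqCoeff] at h1
    have h3 := mul_ne_zero (pow_ne_zero 2 hc) (mul_ne_zero hSl hD)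
    apply h3
    rw [h1]
    ring
  -- Inside one block `S l i = 0`, so the coordinate of a square reduces to twice a product of two
  -- coordinates.
  have key : ∀ i l, i < l → b i = b l → a i * a l = c ^ 2 * (S k i * S k l) := by
    intro i l hil hb
    have h1 := h i l hil
    rw [hS.sqCoeff_row_of_eq hb] at h1
    have h0 : S l i = 0 := by
      by_contra h1
      exact absurd (hS.lt_of_ne_zero l i h1) (by omega)
    rw [sqCoeff, h0] at h1
    apply mul_left_cancel₀ h2
    linear_combination h1
  have key' : i ≠ l → a i * a l = c ^ 2 * (S k i * S k l) := by
    intro hne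
    rcases lt_or_gt_of_ne hne with h1 | h1
    · exact key i l h1 (by omega)
    · rw [mul_comm, key l i h1 (by omega), mul_comm (S k l)]
  by_cases hil : i = l
  · subst hil
    simp [hal, hSl]
  · constructor
    · intro hai h0
      have := key' hil
      rw [h0, zero_mul, mul_zero] at this
      exact mul_ne_zero hai hal this
    · intro hSi h0
      have := key' hil
      rw [h0, zero_mul] at this
      exact mul_ne_zero (pow_ne_zero 2 hc) (mul_ne_zero hSi hSl) this.symm

/-- Before `k` the axis is the negative of the row, and the coefficient is quadratic; at `l = k` the
2 cancels the row entry, and beyond `k` both vectors vanish. -/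
theorem IsBlocked.sqCoeff_axis (hS : IsBlocked S b) (k i l : Fin n) (hil : i < l) :
    sqCoeff S i l (axis S k) = sqCoeff S i l (S k) := by
  have h0 : ∀ m, k ≤ m → S k m = 0 := by
    intro m hm
    by_contra h1
    exact absurd (hS.lt_of_ne_zero k m h1) (not_lt.mpr (hS.mono hm))
  rcases lt_trichotomy l k with h | h | h
  · simp only [sqCoeff, axis, Pi.sub_apply, Pi.smul_apply, Pi.single_eq_of_ne h.ne,
      Pi.single_eq_of_ne (hil.trans h).ne, smul_zero]
    ring
  · subst h
    simp [sqCoeff, axis, h0 l le_rfl, hil.ne]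
  · simp [sqCoeff, axis, h0 l h.le, h.ne']

/-- The matrix of a graded isomorphism between algebras of blocked matrices. -/
theorem exists_perm_of_isBlocked (h2 : (2 : F) ≠ 0) (hT : IsBlocked T b)
    (hS : IsBlocked S b) (hΘ : ∀ a, Θ.mulVec (Γ.mulVec a) = a)
    (hΓ : ∀ a, Γ.mulVec (Θ.mulVec a) = a)
    (hsq : ∀ r i k, i < k →
      sqCoeff S i k (Γ.mulVec (axis T r)) = sqCoeff S i k (Γ.mulVec (T r)))
    (hsq' : ∀ r i k, i < k →
      sqCoeff T i k (Θ.mulVec (axis S r)) = sqCoeff T i k (Θ.mulVec (S r))) :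
    (∀ r k, b r < b k → Γ k r = 0) ∧
    ∃ ρ : Equiv.Perm (Fin n), (∀ k, b (ρ k) = b k) ∧
      (∀ i k, b i = b k → (Γ i k ≠ 0 ↔ k = ρ i)) ∧
      ∀ k i, b i + 1 = b k → (S k i ≠ 0 ↔ T (ρ k) (ρ i) ≠ 0) := by
  have tri := blockTriangular h2 hT hS hΘ hΓ hsq hsq'
  have hz : ∀ r k, b r < b k → Γ k r = 0 := fun r k h => (tri (b k)).1 r k h le_rfl
  obtain ⟨ρ, c, hρ⟩ := exists_perm_axis h2 hT hS hΘ hΓ hsq hsq'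
  have hdiag : ∀ i k, b i = b k → (Γ i k ≠ 0 ↔ k = ρ i) := by
    intro i k hik
    obtain ⟨l, rfl⟩ := ρ.surjective k
    rw [(hρ l).1] at hik
    rw [apply_eq_zero_of_smul_axis h2 hT hS (tri (b l)).1 (hρ l).1 rfl (hρ l).2.2 hik.ge]
    rw [ρ.injective.eq_iff]
    by_cases hl : i = l
    · simp [hl, (hρ l).2.1]
    · simp [hl, Ne.symm hl]
  refine ⟨hz, ρ, fun k => (hρ k).1, hdiag, fun k i hik => ?_⟩
  have hrow : ∀ i' l, i' < l → sqCoeff S i' l (Γ.mulVec (T (ρ k))) =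
      c k ^ 2 * sqCoeff S i' l (S k) := by
    intro i' l hil
    rw [← hsq _ _ _ hil, (hρ k).2.2, sqCoeff_smul, hS.sqCoeff_axis k i' l hil]
  rw [← row_ne_zero_iff h2 hS (hρ k).2.1 hrow hik]
  -- Row `ρ k` of `T` lives in blocks up to that of `i`; lower blocks do not reach coordinate `i` by
  -- triangularity, and in the block of `i` only `ρ i` does.
  have hval : (Γ.mulVec (T (ρ k))) i = Γ i (ρ i) * T (ρ k) (ρ i) := by
    rw [Matrix.mulVec, dotProduct]
    refine Finset.sum_eq_single (ρ i) (fun m _ hm => ?_) (by simp)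
    by_cases hTm : T (ρ k) m = 0
    · rw [hTm, mul_zero]
    · have h1 := hT.lt_of_ne_zero _ _ hTm
      rw [(hρ k).1] at h1
      have h3 : Γ i m = 0 := by
        rcases (show b m ≤ b i by omega).lt_or_eq with h | h
        · exact hz m i h
        · exact not_not.mp fun h4 => hm ((hdiag i m h.symm).mp h4)
      rw [h3, zero_mul]
  rw [hval]
  have : Γ i (ρ i) ≠ 0 := (hdiag i (ρ i) (hρ i).1.symm).mpr rfl
  simp [this]

end Blocks

/-! ### Wall intervals as blocks, measure subintervals as level sets -/

section Combinatorics

variable {F : Type*} [Field F] {n : ℕ}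

/-! ### Walls -/

theorem wallFrom_spec (T : Matrix (Fin n) (Fin n) F) (r : ℕ) (hr : r ≤ n) :
    (wallFrom T r).head? = some r ∧ (wallFrom T r).Pairwise (· < ·) ∧
      ∀ x ∈ wallFrom T r, r ≤ x ∧ x ≤ n := by
  induction h : n - r using Nat.strong_induction_on generalizing r with
  | _ m ih =>
    rw [wallFrom]
    split_ifs with hne
    · have h1 := Finset.min'_mem _ hne
      generalize (wallNext T r).min' hne = s at h1
      rw [wallNext, Finset.mem_filter, Finset.mem_Ioc] at h1
      obtain ⟨-, i2, i3⟩ := ih (n - s) (by omega) s h1.1.2 rfl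
      refine ⟨rfl, List.pairwise_cons.mpr ⟨fun x hx => ?_, i2⟩, fun x hx => ?_⟩
      · have := i3 x hx
        omega
      · rcases List.mem_cons.mp hx with rfl | hx
        · exact ⟨le_rfl, hr⟩
        · have := i3 x hx
          omega
    · refine ⟨rfl, List.pairwise_singleton _ _, fun x hx => ?_⟩
      rw [List.mem_singleton.mp hx]
      exact ⟨le_rfl, hr⟩

/-- These two properties hold whatever representative is chosen, and also for the default values, so
the independence of the wall from the choice plays no role. -/
theorem wall_spec (T : Matrix (Fin n) (Fin n) F) :
    (wall T).Pairwise (· < ·) ∧ ∀ x ∈ wall T, x ≤ n := by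
  classical
  unfold wall
  split_ifs with h
  · unfold oneREFWall
    split_ifs with h'
    · have h1 := Finset.min'_mem _ h'
      rw [Finset.mem_filter, Finset.mem_Icc] at h1
      have := wallFrom_spec h.choose _ h1.1.2
      exact ⟨this.2.1, fun x hx => (this.2.2 x hx).2⟩
    · simp
  · simp

/-- The index 0 is excluded because the wall `(0)` would have `r_0 = 1 > r_1`. Beyond the end of the
wall the default is `n + 1`. -/
theorem cut_lt_cut {w : List ℕ} (hw : w.Pairwise (· < ·)) (hn : ∀ x ∈ w, x ≤ n) {i j : ℕ}
    (hi : 1 ≤ i) (hil : i ≤ w.length) (hij : i < j) : cut n w i < cut n w j := by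
  have h1 : cut n w i = w[i - 1] := by
    rw [cut, if_neg (by omega), List.getD_eq_getElem]
  rw [h1]
  by_cases hj : j ≤ w.length
  · rw [cut, if_neg (by omega), List.getD_eq_getElem _ _ (by omega)]
    exact List.pairwise_iff_getElem.mp hw _ _ _ _ (by omega)
  · rw [cut, if_neg (by omega), List.getD_eq_default _ _ (by omega)]
    have := hn _ (List.getElem_mem (show i - 1 < w.length by omega))
    omega

theorem cut_length_succ (w : List ℕ) : cut n w (w.length + 1) = n + 1 := by
  simp [cut]

/-- The number of the interval of the wall in which an index lies. -/
noncomputable def blockNumber (w : List ℕ) (i : Fin n) : ℕ :=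
  Nat.findGreatest (fun j => cut n w j ≤ (i : ℕ) + 1) w.length

theorem blockNumber_le_length (w : List ℕ) (i : Fin n) : blockNumber w i ≤ w.length :=
  Nat.findGreatest_le _

theorem mem_wallSeg_blockNumber (w : List ℕ) (i : Fin n) :
    i ∈ wallSeg n w (blockNumber w i) := by
  constructor
  · exact Nat.findGreatest_spec (P := fun j => cut n w j ≤ (i : ℕ) + 1) (Nat.zero_le _)
      (by simp [cut])
  · rcases (blockNumber_le_length w i).lt_or_eq with h | h
    · exact not_le.mp (Nat.findGreatest_is_greatest
        (P := fun j => cut n w j ≤ (i : ℕ) + 1) (Nat.lt_succ_self _) h)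
    · rw [h, cut_length_succ]
      omega

theorem mem_wallSeg_iff {w : List ℕ} (hw : w.Pairwise (· < ·)) (hn : ∀ x ∈ w, x ≤ n)
    {i : Fin n} {j : ℕ} (hj : j ≤ w.length) : i ∈ wallSeg n w j ↔ blockNumber w i = j := by
  constructor
  · intro h
    obtain ⟨h1, h2⟩ := mem_wallSeg_blockNumber w i
    have hle := blockNumber_le_length w i
    have key : ∀ a b, 1 ≤ a → a ≤ w.length → a ≤ b → cut n w a ≤ cut n w b := by
      intro a b ha hal hab
      rcases hab.lt_or_eq with h | rfl
      · exact (cut_lt_cut hw hn ha hal h).le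
      · exact le_rfl
    rcases lt_trichotomy (blockNumber w i) j with hlt | heq | hgt
    · have := key (blockNumber w i + 1) j (by omega) (by omega) hlt
      have := h.1
      omega
    · exact heq
    · have := key (j + 1) (blockNumber w i) (by omega) (by omega) hgt
      have := h.2
      omega
  · rintro rfl
    exact mem_wallSeg_blockNumber w i

theorem blockNumber_mono (w : List ℕ) : Monotone (blockNumber (n := n) w) := by
  intro i k hik
  refine Nat.le_findGreatest (blockNumber_le_length w i) ?_
  exact (mem_wallSeg_blockNumber w i).1.trans (by
    have : (i : ℕ) ≤ k := hik
    omega)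

theorem cut_le_iff {w : List ℕ} (hw : w.Pairwise (· < ·)) (hn : ∀ x ∈ w, x ≤ n)
    {k : Fin n} {j : ℕ} (hj : 1 ≤ j) : cut n w j ≤ (k : ℕ) + 1 ↔ j ≤ blockNumber w k := by
  by_cases hjl : j ≤ w.length
  · obtain ⟨h1, h2⟩ := mem_wallSeg_blockNumber w k
    constructor
    · intro h
      exact Nat.le_findGreatest hjl h
    · intro h
      rcases h.lt_or_eq with h | h
      · exact (cut_lt_cut hw hn hj hjl h).le.trans h1
      · rw [h]
        exact h1
  · have := blockNumber_le_length w k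
    rw [cut, if_neg (by omega), List.getD_eq_default _ _ (by omega)]
    omega

/-! ### Rows and leaders -/

theorem entry_ne_zero_bounds {T : Matrix (Fin n) (Fin n) F} {r c : ℕ} (h : entry T r c ≠ 0) :
    1 ≤ c ∧ c ≤ n := by
  by_contra h1
  apply h
  rw [entry, dif_neg]
  tauto

theorem le_lead {T : Matrix (Fin n) (Fin n) F} {r c : ℕ} (h : entry T r c ≠ 0) :
    c ≤ lead T r := by
  classical
  refine Finset.le_sup (f := id) (b := c) ?_
  rw [Finset.mem_filter, Finset.mem_Icc]
  exact ⟨entry_ne_zero_bounds h, h⟩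

theorem entry_lead_ne_zero {T : Matrix (Fin n) (Fin n) F} {r : ℕ} (h : 0 < lead T r) :
    entry T r (lead T r) ≠ 0 := by
  classical
  have hne : ((Finset.Icc 1 n).filter (fun c => entry T r c ≠ 0)).Nonempty := by
    by_contra h1
    rw [Finset.not_nonempty_iff_eq_empty] at h1
    rw [lead, h1] at h
    simp at h
  obtain ⟨c, hc, he⟩ := Finset.exists_mem_eq_sup _ hne id
  have : lead T r = c := he
  rw [this]
  exact (Finset.mem_filter.mp hc).2

/-- All that the block argument needs from the echelon form: the leader of a row bounds its support
and lies exactly one interval lower. -/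
theorem IsTwoREF.isBlocked {T : Matrix (Fin n) (Fin n) F} (hT0 : T ≠ 0) (hT2 : IsTwoREF T) :
    IsBlocked T (blockNumber (wall T)) := by
  classical
  obtain ⟨-, hcard, hzero, hred, hlead, -⟩ := hT2.resolve_left hT0
  obtain ⟨hw, hn⟩ := wall_spec T
  have hl : ∀ r : Fin n, 0 < blockNumber (wall T) r →
      lead T ((r : ℕ) + 1) ∈ Finset.Ico (cut n (wall T) (blockNumber (wall T) r - 1))
        (cut n (wall T) (blockNumber (wall T) r)) := by
    intro r hr
    have h1 := mem_wallSeg_blockNumber (wall T) r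
    exact hlead _ (Finset.mem_Icc.mpr ⟨hr, blockNumber_le_length _ _⟩) _
      (Finset.mem_Ico.mpr h1)
  -- A nonzero row has all zero rows above it, so its number is at least their count plus one, which
  -- is `r_1`.
  have hr0 : ∀ r : Fin n, blockNumber (wall T) r = 0 → ZeroRow T ((r : ℕ) + 1) := by
    intro r hr
    by_contra hz
    have h1 := (mem_wallSeg_blockNumber (wall T) r).2
    rw [hr, zero_add, ← hcard] at h1
    have h3 : (Finset.Icc 1 n).filter (fun s => ZeroRow T s) ⊆ Finset.Icc 1 (r : ℕ) := by
      intro s hs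
      rw [Finset.mem_filter] at hs
      have h4 := hzero s hs.1 ((r : ℕ) + 1) (Finset.mem_Icc.mpr ⟨by omega, r.isLt⟩) hs.2 hz
      rw [Finset.mem_Icc] at hs ⊢
      omega
    have h4 := Finset.card_le_card h3
    rw [Nat.card_Icc] at h4
    omega
  refine ⟨blockNumber_mono _, fun r m hrm => ?_, fun r hr => ?_⟩
  · rw [← entry_succ T r m] at hrm
    rcases Nat.eq_zero_or_pos (blockNumber (wall T) r) with h | h
    · exact absurd (hr0 r h _ (Finset.mem_Icc.mpr ⟨by omega, m.isLt⟩)) hrm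
    · have h1 := (Finset.mem_Ico.mp (hl r h)).2
      have h2 := le_lead hrm
      by_contra h3
      have := (cut_le_iff hw hn (k := m) h).mpr (not_lt.mp h3)
      omega
  · have h1 := Finset.mem_Ico.mp (hl r hr)
    -- The lower end of the interval of the leader is positive: `r_0 = 1`, and `r_1` is the number
    -- of zero rows plus one.
    have hlpos : 0 < lead T ((r : ℕ) + 1) := by
      by_contra h0
      have h2 : cut n (wall T) (blockNumber (wall T) r - 1) = 0 := by omega
      rcases Nat.eq_zero_or_pos (blockNumber (wall T) r - 1) with h3 | h3
      · rw [h3] at h2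
        simp [cut] at h2
      · have h4 : cut n (wall T) 1 ≤ cut n (wall T) (blockNumber (wall T) r - 1) := by
          rcases (show 1 ≤ blockNumber (wall T) r - 1 from h3).lt_or_eq with h5 | h5
          · have := blockNumber_le_length (wall T) r
            exact (cut_lt_cut hw hn le_rfl (by omega) h5).le
          · rw [← h5]
        omega
    have hle := entry_lead_ne_zero hlpos
    have hb := entry_ne_zero_bounds hle
    have hnz : ¬ ZeroRow T ((r : ℕ) + 1) := fun hz => hle (hz _ (Finset.mem_Icc.mpr hb))
    obtain ⟨-, i, hi, hD⟩ := hred _ (Finset.mem_Icc.mpr ⟨by omega, r.isLt⟩) hnz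
    generalize lead T ((r : ℕ) + 1) = c at *
    obtain ⟨c, rfl⟩ : ∃ d, c = d + 1 := ⟨c - 1, by omega⟩
    rw [Finset.mem_Ico] at hi
    obtain ⟨i, rfl⟩ : ∃ d, i = d + 1 := ⟨i - 1, by omega⟩
    let c' : Fin n := ⟨c, by omega⟩
    let i' : Fin n := ⟨i, by omega⟩
    refine ⟨c', ?_, ?_, i', ?_, ?_⟩
    · have h2 : c' ∈ wallSeg n (wall T) (blockNumber (wall T) r - 1) := by
        refine ⟨h1.1, ?_⟩
        rw [Nat.sub_add_cancel hr]
        exact h1.2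
      have := blockNumber_le_length (wall T) r
      rw [(mem_wallSeg_iff hw hn (by omega)).mp h2]
      omega
    · rw [← entry_succ T r c']
      exact hle
    · exact Fin.mk_lt_mk.mpr (by omega)
    · rw [← entry_succ T r i', ← entry_succ T r c', ← entry_succ T c' i']
      exact hD

/-! ### Measures -/

theorem mem_measureFrom (T : Matrix (Fin n) (Fin n) F) (a b e r : ℕ) (hre : r < e)
    (x : ℕ × ℕ) (hx : x ∈ measureFrom T a b e r) :
    r ≤ x.1 ∧ x.1 < e ∧ rowMeasure T a b r ≤ x.2 := by
  induction h : e - r using Nat.strong_induction_on generalizing r with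
  | _ m ih =>
    rw [measureFrom] at hx
    split_ifs at hx with hne
    · have h1 := Finset.min'_mem _ hne
      generalize (measureNext T a b e r).min' hne = s at h1 hx
      rw [measureNext, Finset.mem_filter, Finset.mem_Ioo] at h1
      rcases List.mem_cons.mp hx with rfl | hx
      · exact ⟨le_rfl, hre, le_rfl⟩
      · have := ih (e - s) (by omega) s h1.1.2 hx rfl
        omega
    · rw [List.mem_singleton.mp hx]
      exact ⟨le_rfl, hre, le_rfl⟩

theorem measureFrom_head (T : Matrix (Fin n) (Fin n) F) (a b e r : ℕ) :
    ∃ l, measureFrom T a b e r = (r, rowMeasure T a b r) :: l := by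
  rw [measureFrom]
  split_ifs
  · exact ⟨_, rfl⟩
  · exact ⟨_, rfl⟩

/-- The subintervals of a measure matrix are the level sets of the measure. -/
theorem measureFrom_interval (T : Matrix (Fin n) (Fin n) F) (a b e r : ℕ) (hre : r < e)
    (hmono : ∀ s t, r ≤ s → s ≤ t → t < e → rowMeasure T a b s ≤ rowMeasure T a b t)
    (i : ℕ) (hi : i < (measureFrom T a b e r).length) (s : ℕ) :
    (((measureFrom T a b e r).map Prod.fst).getD i e ≤ s ∧
      s < ((measureFrom T a b e r).map Prod.fst).getD (i + 1) e) ↔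
    r ≤ s ∧ s < e ∧ rowMeasure T a b s = ((measureFrom T a b e r)[i]).2 := by
  induction h : e - r using Nat.strong_induction_on generalizing r i with
  | _ m ih =>
    by_cases hne : (measureNext T a b e r).Nonempty
    · have h1 := Finset.min'_mem _ hne
      have hmin : ∀ t ∈ measureNext T a b e r, (measureNext T a b e r).min' hne ≤ t :=
        fun t ht => Finset.min'_le _ t ht
      have hL : measureFrom T a b e r = (r, rowMeasure T a b r) ::
          measureFrom T a b e ((measureNext T a b e r).min' hne) := by
        rw [measureFrom, dif_pos hne]
      generalize (measureNext T a b e r).min' hne = u at h1 hL hmin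
      rw [measureNext, Finset.mem_filter, Finset.mem_Ioo] at h1
      -- By monotonicity and minimality of `u`, the measure is constant up to its first strict
      -- increase.
      have hlow : ∀ t, r ≤ t → t < u → rowMeasure T a b t = rowMeasure T a b r := by
        intro t h3 h4
        refine le_antisymm ?_ (hmono r t le_rfl h3 (by omega))
        by_contra h5
        have : t ∈ measureNext T a b e r := by
          rw [measureNext, Finset.mem_filter, Finset.mem_Ioo]
          refine ⟨⟨?_, by omega⟩, by omega⟩
          rcases h3.lt_or_eq with h6 | h6
          · exact h6
          · subst h6
            omega
        have := hmin t this
        omega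
      simp only [hL]
      rw [hL, List.length_cons] at hi
      cases i with
      | zero =>
        obtain ⟨l, hl⟩ := measureFrom_head T a b e u
        simp only [hl, List.map_cons, List.getD_cons_zero, List.getD_cons_succ, zero_add,
          List.getElem_cons_zero]
        constructor
        · rintro ⟨h3, h4⟩
          exact ⟨h3, by omega, hlow s h3 h4⟩
        · rintro ⟨h3, h4, h5⟩
          refine ⟨h3, ?_⟩
          by_contra h6
          have := hmono u s (by omega) (by omega) h4
          omega
      | succ i =>
        simp only [List.map_cons, List.getD_cons_succ, List.getElem_cons_succ]
        rw [ih (e - u) (by omega) u h1.1.2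
          (fun s t h3 h4 h5 => hmono s t (by omega) h4 h5) i (by omega) rfl]
        constructor
        · rintro ⟨h3, h4, h5⟩
          exact ⟨by omega, h4, h5⟩
        · rintro ⟨h3, h4, h5⟩
          refine ⟨?_, h4, h5⟩
          by_contra h6
          have h7 := hlow s h3 (by omega)
          -- Every measure in the tail is at least that of `u`, hence exceeds the value taken before
          -- `u`.
          have h8 := (mem_measureFrom T a b e u h1.1.2 _
            (List.getElem_mem (show i < _ by omega))).2.2
          omega
    -- No increase remains, so the last subinterval runs up to the default `e`.
    · have hL : measureFrom T a b e r = [(r, rowMeasure T a b r)] := by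
        rw [measureFrom, dif_neg hne]
      simp only [hL]
      rw [hL] at hi
      obtain rfl : i = 0 := by simpa using hi
      simp only [List.map_cons, List.map_nil, List.getD_cons_zero, List.getD_cons_succ,
        List.getD_nil, List.getElem_cons_zero]
      constructor
      · rintro ⟨h3, h4⟩
        refine ⟨h3, h4, le_antisymm ?_ (hmono r s le_rfl h3 h4)⟩
        by_contra h5
        apply hne
        refine ⟨s, ?_⟩
        rw [measureNext, Finset.mem_filter, Finset.mem_Ioo]
        refine ⟨⟨?_, h4⟩, by omega⟩
        rcases h3.lt_or_eq with h6 | h6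
        · exact h6
        · subst h6
          omega
      · rintro ⟨h3, h4, -⟩
        exact ⟨h3, h4⟩

theorem rowMeasure_eq_ncard (T : Matrix (Fin n) (Fin n) F) (a b : ℕ) (r : Fin n) :
    rowMeasure T a b ((r : ℕ) + 1) = {j : Fin n | j ∈ seg n a b ∧ T r j ≠ 0}.ncard := by
  classical
  rw [rowMeasure, ← Set.ncard_coe_finset,
    ← Set.ncard_image_of_injective (f := fun j : Fin n => (j : ℕ) + 1) _
      (fun i j h => Fin.ext (Nat.succ_injective h))]
  congr 1
  ext c
  simp only [Finset.coe_filter, Finset.mem_Ico, Set.mem_ofPred_eq, Set.mem_image, seg]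
  constructor
  · rintro ⟨h1, h2⟩
    have h3 := entry_ne_zero_bounds h2
    obtain ⟨c, rfl⟩ : ∃ d, c = d + 1 := ⟨c - 1, by omega⟩
    refine ⟨⟨c, by omega⟩, ⟨h1, ?_⟩, rfl⟩
    have h4 := entry_succ T r ⟨c, by omega⟩
    exact fun h0 => h2 (h4.trans h0)
  · rintro ⟨j, ⟨h1, h2⟩, rfl⟩
    refine ⟨h1, ?_⟩
    rw [entry_succ]
    exact h2

/-- The subintervals of the measure matrix number `j` are the level sets of the measure. -/
theorem IsTwoREF.mem_subSeg_iff {T : Matrix (Fin n) (Fin n) F} (hT0 : T ≠ 0)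
    (hT2 : IsTwoREF T) {j : ℕ} (hj : j ∈ Finset.Icc 1 (wall T).length) {M : List (ℕ × ℕ)}
    (hM : measureMatrix T j = M) {i : ℕ} (hi : i < M.length) (k : Fin n) :
    k ∈ seg n (subCut T j (i + 1)) (subCut T j (i + 1 + 1)) ↔
      k ∈ wallSeg n (wall T) j ∧ (brickSupport T j k).ncard = M[i].2 := by
  subst hM
  obtain ⟨-, -, -, -, -, hmeas⟩ := hT2.resolve_left hT0
  obtain ⟨hw, hn⟩ := wall_spec T
  have hmono : ∀ s t, cut n (wall T) j ≤ s → s ≤ t → t < cut n (wall T) (j + 1) →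
      rowMeasure T (cut n (wall T) (j - 1)) (cut n (wall T) j) s ≤
        rowMeasure T (cut n (wall T) (j - 1)) (cut n (wall T) j) t := by
    intro s t hs hst
    induction t, hst using Nat.le_induction with
    | base => exact fun _ => le_rfl
    | succ t hst ih =>
      intro ht
      exact (ih (by omega)).trans
        (hmeas j hj t (Finset.mem_Ico.mpr ⟨hs.trans hst, by omega⟩))
  have hj' := Finset.mem_Icc.mp hj
  have := measureFrom_interval T _ _ _ _
    (cut_lt_cut hw hn hj'.1 hj'.2 (Nat.lt_succ_self j)) hmono i hi ((k : ℕ) + 1)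
  rw [rowMeasure_eq_ncard] at this
  have hb : {m : Fin n | m ∈ seg n (cut n (wall T) (j - 1)) (cut n (wall T) j) ∧ T k m ≠ 0} =
      brickSupport T j k := by
    rw [brickSupport, wallSeg, Nat.sub_add_cancel hj'.1]
  rw [hb] at this
  refine this.trans ?_
  rw [← and_assoc]
  rfl

theorem measureMatrix_eq {T S : Matrix (Fin n) (Fin n) F} (hW : wall T = wall S)
    (hM : measureSequence T = measureSequence S) {j : ℕ}
    (hj : j ∈ Finset.Icc 1 (wall T).length) : measureMatrix T j = measureMatrix S j := by
  rw [Finset.mem_Icc] at hj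
  unfold measureSequence at hM
  rw [← hW] at hM
  have := List.map_inj_left.mp hM (j - 1) (List.mem_range.mpr (by omega))
  rwa [Nat.sub_add_cancel hj.1] at this

theorem subCut_eq {T S : Matrix (Fin n) (Fin n) F} (hW : wall T = wall S) {j : ℕ}
    (hM : measureMatrix T j = measureMatrix S j) (i : ℕ) : subCut T j i = subCut S j i := by
  rw [subCut, subCut, hM, hW]

end Combinatorics

/-! ### Transfer to brick supports and the theorem -/

section Main

variable {F : Type*} [Field F] {n : ℕ}

/-- A permutation that maps a set of indices into itself maps it onto itself. -/
theorem image_eq_of_forall_mem (ρ : Equiv.Perm (Fin n)) (A : Set (Fin n))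
    (h : ∀ k ∈ A, ρ k ∈ A) : ρ '' A = A := by
  refine Set.eq_of_subset_of_ncard_le ?_ ?_ A.toFinite
  · rintro _ ⟨k, hk, rfl⟩
    exact h k hk
  · rw [Set.ncard_image_of_injective _ ρ.injective]

theorem image_brickSupport {T S : Matrix (Fin n) (Fin n) F} (hW : wall T = wall S)
    {ρ : Equiv.Perm (Fin n)}
    (hρ : ∀ k, blockNumber (wall T) (ρ k) = blockNumber (wall T) k)
    (hrow : ∀ k i, blockNumber (wall T) i + 1 = blockNumber (wall T) k →
      (S k i ≠ 0 ↔ T (ρ k) (ρ i) ≠ 0)) {q : ℕ} (hq : q ∈ Finset.Icc 1 (wall T).length)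
    {k : Fin n} (hk : k ∈ wallSeg n (wall T) q) :
    ρ '' brickSupport S q k = brickSupport T q (ρ k) := by
  obtain ⟨hw, hn⟩ := wall_spec T
  rw [Finset.mem_Icc] at hq
  rw [mem_wallSeg_iff hw hn hq.2] at hk
  ext m
  obtain ⟨i, rfl⟩ := ρ.surjective m
  rw [ρ.injective.mem_set_image]
  simp only [brickSupport, Set.mem_ofPred_eq, ← hW]
  rw [mem_wallSeg_iff hw hn (by omega), mem_wallSeg_iff hw hn (by omega), hρ]
  exact and_congr_right fun h => hrow k i (by omega)

/-- A graded isomorphism has a block triangular matrix whose diagonal blocks are monomial. -/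
theorem IsGraded.exists_perm (h2 : (2 : F) ≠ 0) {T S : Matrix (Fin n) (Fin n) F}
    (hT : IsSLTM T) (hS : IsSLTM S) {b : Fin n → ℕ} (hbT : IsBlocked T b) (hbS : IsBlocked S b)
    {γ : NilAlg T ≃ₐ[F] NilAlg S} (hγ : IsGraded γ) :
    ∃ Γ : Matrix (Fin n) (Fin n) F, IsMatrixOf γ Γ ∧ (∀ r k, b r < b k → Γ k r = 0) ∧
      ∃ ρ : Equiv.Perm (Fin n), (∀ k, b (ρ k) = b k) ∧
        (∀ i k, b i = b k → (Γ i k ≠ 0 ↔ k = ρ i)) ∧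
        ∀ k i, b i + 1 = b k → (S k i ≠ 0 ↔ T (ρ k) (ρ i) ≠ 0) := by
  obtain ⟨Γ, hΓ⟩ := hγ.exists_isMatrixOf
  obtain ⟨Θ, hΘ⟩ := hγ.symm.exists_isMatrixOf
  have h1 := hΓ.mulVec_mulVec hT hΘ
  have h3 := hΓ.mulVec_mulVec_symm hS hΘ
  have h4 : ∀ r i k, i < k →
      sqCoeff S i k (Γ.mulVec (axis T r)) = sqCoeff S i k (Γ.mulVec (T r)) :=
    fun r i k => hΓ.sqCoeff_eq h2 hT hS r
  have h5 : ∀ r i k, i < k →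
      sqCoeff T i k (Θ.mulVec (axis S r)) = sqCoeff T i k (Θ.mulVec (S r)) :=
    fun r i k => hΘ.sqCoeff_eq h2 hS hT r
  exact ⟨Γ, hΓ, exists_perm_of_isBlocked h2 hbT hbS h1 h3 h4 h5⟩

end Main

end NT

theorem mainTheorem8 {F : Type*} [Field F] (hF : ringChar F ≠ 2) {n : ℕ}
    (T S : Matrix (Fin n) (Fin n) F) (hT : NT.IsSLTM T) (hS : NT.IsSLTM S)
    (hT0 : T ≠ 0) (hS0 : S ≠ 0) (hT2 : NT.IsTwoREF T) (hS2 : NT.IsTwoREF S)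
    (hW : NT.wall T = NT.wall S) (hM : NT.measureSequence T = NT.measureSequence S)
    (γ : NT.NilAlg T ≃ₐ[F] NT.NilAlg S) (hγ : NT.IsGraded γ) :
    ∃ Γ : Matrix (Fin n) (Fin n) F,
      (∀ Γ' : Matrix (Fin n) (Fin n) F, NT.IsMatrixOf γ Γ' ↔ Γ' = Γ) ∧
      (∀ j ∈ Finset.Icc 0 (NT.wall T).length, ∀ r ∈ NT.wallSeg n (NT.wall T) j,
        ∀ k : Fin n, NT.cut n (NT.wall T) (j + 1) ≤ (k : ℕ) + 1 → Γ k r = 0) ∧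
      (∃ ρ : Equiv.Perm (Fin n), NT.IsAdapted T Γ ρ) ∧
      (∀ ρ : Equiv.Perm (Fin n), NT.IsAdapted T Γ ρ →
        ∀ q ∈ Finset.Icc 1 (NT.wall T).length, ∀ k ∈ NT.wallSeg n (NT.wall T) q,
          ρ '' NT.brickSupport S q k = NT.brickSupport T q (ρ k)) := by
  have h2 : (2 : F) ≠ 0 := Ring.two_ne_zero hF
  obtain ⟨hw, hn⟩ := NT.wall_spec T
  have hbT := hT2.isBlocked hT0
  have hbS := hS2.isBlocked hS0
  rw [← hW] at hbS
  obtain ⟨Γ, hΓ, htri, ρ, hρ, hdiag, hrow⟩ := hγ.exists_perm h2 hT hS hbT hbS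
  refine ⟨Γ, fun Γ' => ⟨fun h => hΓ.unique hS h, fun h => h ▸ hΓ⟩, ?_, ⟨ρ, ?_, ?_, ?_⟩, ?_⟩
  · intro j hj r hr k hk
    rw [NT.mem_wallSeg_iff hw hn (Finset.mem_Icc.mp hj).2] at hr
    rw [NT.cut_le_iff hw hn (by omega)] at hk
    exact htri r k (by omega)
  · intro j hj
    refine NT.image_eq_of_forall_mem ρ _ fun k hk => ?_
    rw [NT.mem_wallSeg_iff hw hn (Finset.mem_Icc.mp hj).2] at hk ⊢
    rw [hρ, hk]
  · intro j hj i hi k hk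
    rw [NT.mem_wallSeg_iff hw hn (Finset.mem_Icc.mp hj).2] at hi hk
    exact hdiag i k (by omega)
  · intro j hj i hi
    have hMj := NT.measureMatrix_eq hW hM hj
    obtain ⟨i, rfl⟩ : ∃ d, i = d + 1 := ⟨i - 1, by have := (Finset.mem_Icc.mp hi).1; omega⟩
    have hi' : i < (NT.measureMatrix T j).length := (Finset.mem_Icc.mp hi).2
    refine NT.image_eq_of_forall_mem ρ _ fun k hk => ?_
    have hkS := hk
    have hjS : j ∈ Finset.Icc 1 (NT.wall S).length := by rwa [← hW]
    rw [NT.subCut_eq hW hMj, NT.subCut_eq hW hMj, hS2.mem_subSeg_iff hS0 hjS hMj.symm hi',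
      ← hW] at hkS
    -- The subinterval is read as a level set for `S` at `k` and for `T` at `ρ k`; the bijection of
    -- supports identifies the two measures.
    rw [hT2.mem_subSeg_iff hT0 hj rfl hi', ← NT.image_brickSupport hW hρ hrow hj hkS.1,
      Set.ncard_image_of_injective _ ρ.injective, hkS.2]
    have hkT := hkS.1
    have hj' := (Finset.mem_Icc.mp hj).2
    rw [NT.mem_wallSeg_iff hw hn hj'] at hkT ⊢
    exact ⟨by rw [hρ, hkT], rfl⟩
  · intro ρ' hρ' q hq k hk
    -- Preservation of the wall intervals and the nonzero pattern of the diagonal blocks already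
    -- determine the permutation.
    have heq : ρ' = ρ := by
      ext1 i
      have hi := NT.mem_wallSeg_blockNumber (NT.wall T) i
      have hle := NT.blockNumber_le_length (NT.wall T) i
      have hm : NT.blockNumber (NT.wall T) i ∈ Finset.Icc 0 (NT.wall T).length :=
        Finset.mem_Icc.mpr ⟨Nat.zero_le _, hle⟩
      have hi' : ρ' i ∈ NT.wallSeg n (NT.wall T) (NT.blockNumber (NT.wall T) i) := by
        rw [← hρ'.image_wallSeg _ hm]
        exact ⟨i, hi, rfl⟩
      have hne := (hρ'.ne_zero_iff _ hm i hi _ hi').mpr rfl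
      rw [NT.mem_wallSeg_iff hw hn hle] at hi'
      exact (hdiag i _ hi'.symm).mp hne
    subst heq
    exact NT.image_brickSupport hW hρ hrow hq hk
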